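/- Let $C$ be a smooth projective geometrically irreducible curve over a finite field $\mathbb{F}$ with $q$ elements, $\infty$ a closed point of $C$, $A=H^0(C\setminus\{\infty\},\mathcal{O}_C)$, $K$ the function field of $C$, and $L$ an extension field of $K$ (for example a field between $K$ and the completion $\mathbb{C}_\infty$ of an algebraic closure of $K$ at a place above $\infty$). Unlabelled tensor products are over $\mathbb{F}$; the ring $A\otimes L$ is a domain. Write $h\mapsto h^{(1)}$ for the ring endomorphism of $A\otimes L$ with $(a\otimes x)^{(1)}=a\otimes x^q$, for its extension to the fraction field of $A\otimes L$, and $h\mapsto h^{(n)}$ for its $n$-th iterate. Let $(E,\phi)$ be a Drinfeld–Hayes module over $L$. That is: $E$ is an $\mathbb{F}$-vector space scheme over $L$ isomorphic to $\mathbb{G}_{a,L}$; $\phi:A\to\operatorname{End}_{\mathbb{F},L}(E)$, $a\mapsto\phi_a$, is a homomorphism of $\mathbb{F}$-algebras such that $\partial\phi_a-a$ is nilpotent on $\operatorname{Lie}_E(L)$ for all $a\in A$; and the motive $\mathsf{M}=\operatorname{Hom}_{\mathbb{F},L}(E,\mathbb{G}_{a,L})$, on which $a\in A$ acts by $m\mapsto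 m\circ\phi_a$ and $l\in L$ by $m\mapsto l\cdot m$, is a finitely generated $A\otimes L$-module of rank one. Let $\kappa:E\to\mathbb{G}_{a,L}$ be an isomorphism of $\mathbb{F}$-vector space schemes over $L$, and let $\operatorname{Frob}_q$ and $\tau$ both denote the $q$-power Frobenius endomorphism of $\mathbb{G}_{a,L}$. Then: 1. There is a unique element $f_\kappa$ of the fraction field of $A\otimes L$ (the shtuka function of $E$ associated to $\kappa$) such that $\operatorname{Frob}_q\circ\kappa=f_\kappa\cdot\kappa$ in $\operatorname{Frac}(A\otimes L)\otimes_{A\otimes L}\mathsf{M}$. 2. For every $a\in A$ there is a unique finitely supported family $((a)^\kappa_n)_{n\ge 0}$ of elements of $L$ such that $\kappa\circ\phi_a\circ\kappa^{-1}=\sum_{n\ge 0}(a)^\kappa_n\tau^n$ in $\operatorname{End}_{\mathbb{F},L}(\mathbb{G}_{a,L})$. 3. For every $a\in A$, the following identity holds in the fraction field of $A\otimes L$: $$a\otimes 1=\sum_{n\ge 0}\bigl(1\otimes (a)^\kappa_n\bigr)\,f_\kappa^{(n-1)}\cdots f_\kappa^{(1)}f_\kappa .$$ -/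

import Mathlib

universe u

open CategoryTheory AlgebraicGeometry Opposite
open scoped TensorProduct

noncomputable section

namespace DrinfeldHayes

/-- The ring of sections `Γ(X, U)` of a scheme `X` over `Spec R`, seen as an algebra over `R` and over
every ring that `R` is an algebra over. -/
def Sections {R : Type u} [CommRing R] (X : Over (Spec (CommRingCat.of R)))
    (U : X.left.Opens) : Type u := Γ(X.left, U)

namespace Sections

variable {R : Type u} [CommRing R] (X : Over (Spec (CommRingCat.of R))) (U : X.left.Opens)

instance : CommRing (Sections X U) := inferInstanceAs (CommRing Γ(X.left, U))

/-- The structural ring homomorphism `R → Γ(X, U)`. -/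
def structureMap : R →+* Sections X U :=
  ((Scheme.ΓSpecIso (CommRingCat.of R)).inv ≫ X.hom.appTop ≫
    X.left.presheaf.map (homOfLE le_top).op).hom

instance {F : Type u} [CommRing F] [Algebra F R] : Algebra F (Sections X U) :=
  ((structureMap X U).comp (algebraMap F R)).toAlgebra

end Sections

/-- A smooth projective geometrically irreducible curve `C` over the field `F`, with a closed point `∞`.
Smooth of relative dimension one and geometrically irreducible imply integral, which is recorded for
convenience only; for such curves proper and projective mean the same. -/
structure PointedCurve (F : Type u) [Field F] where
  C : Over (Spec (CommRingCat.of F))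
  isIntegral : AlgebraicGeometry.IsIntegral C.left
  isProper : IsProper C.hom
  smooth : SmoothOfRelativeDimension 1 C.hom
  geometricallyIrreducible : GeometricallyIrreducible C.hom
  infty : C.left
  isClosed_infty : IsClosed ({infty} : Set C.left)

namespace PointedCurve

variable {F : Type u} [Field F] (X : PointedCurve F)

attribute [instance] isIntegral isProper smooth geometricallyIrreducible

/-- The open subscheme `C ∖ {∞}`. -/
def affinePart : X.C.left.Opens := ⟨{X.infty}ᶜ, X.isClosed_infty.isOpen_compl⟩

/-- A curve does not consist of its point `∞` only. -/
theorem nonempty_affinePart [Finite F] : Nonempty X.affinePart := by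
  by_contra hne
  have hsub : ∀ x : X.C.left, x = X.infty := by
    intro x
    by_contra hx
    exact hne ⟨⟨x, hx⟩⟩
  have : Subsingleton X.C.left := ⟨fun x y => (hsub x).trans (hsub y).symm⟩
  obtain ⟨W, hW, V, hV, hx, e, hf⟩ :=
    SmoothOfRelativeDimension.exists_isStandardSmoothOfRelativeDimension (n := 1)
      (f := X.C.hom) X.infty
  have hVtop : V = ⊤ := by
    ext y; simp only [SetLike.mem_coe, TopologicalSpace.Opens.coe_top, Set.mem_univ, iff_true]
    rw [hsub y]; exact hx
  have hWtop : W = ⊤ := by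
    ext y
    simp only [SetLike.mem_coe, TopologicalSpace.Opens.coe_top, Set.mem_univ, iff_true]
    rw [Subsingleton.elim y (X.C.hom X.infty)]
    exact e hx
  subst hVtop hWtop
  let e0 : Γ(Spec (CommRingCat.of F), ⊤) ≃+* F :=
    (Scheme.ΓSpecIso (CommRingCat.of F)).commRingCatIsoToRingEquiv
  let : Field Γ(Spec (CommRingCat.of F), ⊤) := (e0.toMulEquiv.isField (Field.toIsField F)).toField
  have : Finite Γ(Spec (CommRingCat.of F), ⊤) := Finite.of_equiv F e0.symm.toEquiv
  have hfield : IsField Γ(X.C.left, ⊤) := isField_of_isIntegral_of_subsingleton _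
  let : Field Γ(X.C.left, ⊤) := hfield.toField
  let := (X.C.hom.appLE ⊤ ⊤ e).hom.toAlgebra
  have hsm : Algebra.IsStandardSmoothOfRelativeDimension 1
    Γ(Spec (CommRingCat.of F), ⊤) Γ(X.C.left, ⊤) := hf
  have hft : Algebra.FiniteType Γ(Spec (CommRingCat.of F), ⊤) Γ(X.C.left, ⊤) :=
    have := hsm.isStandardSmooth
    inferInstance
  have hfin : Module.Finite Γ(Spec (CommRingCat.of F), ⊤) Γ(X.C.left, ⊤) :=
    finite_of_finite_type_of_isJacobsonRing _ _
  have hunr : Algebra.FormallyUnramified Γ(Spec (CommRingCat.of F), ⊤) Γ(X.C.left, ⊤) :=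
    Algebra.FormallyUnramified.of_isSeparable _ _
  have h1 := Algebra.IsStandardSmoothOfRelativeDimension.rank_kaehlerDifferential
    (R := Γ(Spec (CommRingCat.of F), ⊤)) (S := Γ(X.C.left, ⊤)) 1
  have h0 : Subsingleton (Ω[Γ(X.C.left, ⊤)⁄Γ(Spec (CommRingCat.of F), ⊤)]) := inferInstance
  rw [rank_subsingleton'] at h1
  simp at h1

end PointedCurve

/-- Over a finite field, a tensor product of reduced algebras is reduced. -/
theorem isReduced_tensor (F A L : Type*) [Field F] [Fintype F] [CommRing A] [IsReduced A]
    [Algebra F A] [CommRing L] [IsReduced L] [Algebra F L] : IsReduced (A ⊗[F] L) := by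
  have inj : Function.Injective (FiniteField.frobeniusAlgHom F A) := by
    rw [injective_iff_map_eq_zero]
    intro b hb
    exact eq_zero_of_pow_eq_zero hb
  have inj' : Function.Injective (FiniteField.frobeniusAlgHom F L) := by
    rw [injective_iff_map_eq_zero]
    intro b hb
    exact eq_zero_of_pow_eq_zero hb
  have key : FiniteField.frobeniusAlgHom F (A ⊗[F] L) =
      Algebra.TensorProduct.map (FiniteField.frobeniusAlgHom F A)
        (FiniteField.frobeniusAlgHom F L) := by
    ext x <;> simp [Algebra.TensorProduct.tmul_pow]
  have hinj : Function.Injective (FiniteField.frobeniusAlgHom F (A ⊗[F] L)) := by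
    rw [key]
    exact TensorProduct.map_injective_of_flat_flat _ _ inj inj'
  rw [isReduced_iff_pow_one_lt _ (Fintype.one_lt_card (α := F))]
  intro x hx
  exact hinj (by simpa using hx)

theorem isDomain_tensor_affine {F : Type u} [Field F] [Fintype F]
    (X : PointedCurve F) (V : X.C.left.Opens) (hV : IsAffineOpen V) [Nonempty V]
    (L : Type u) [Field L] [Algebra F L] :
    IsDomain (Sections X.C V ⊗[F] L) := by
  have hdom : IsDomain (Sections X.C V) := inferInstanceAs (IsDomain Γ(X.C.left, V))
  have hred : IsReduced (Sections X.C V ⊗[F] L) := isReduced_tensor F _ L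
  have hmap : hV.fromSpec ≫ X.C.hom = Spec.map (CommRingCat.ofHom
      (algebraMap F (Sections X.C V))) := by
    have h := IsAffineOpen.SpecMap_appLE_fromSpec X.C.hom
      (isAffineOpen_top (Spec (CommRingCat.of F))) hV (fun _ _ => trivial)
    rw [← h, IsAffineOpen.fromSpec_top (X := Spec (CommRingCat.of F)), Scheme.isoSpec_Spec_inv]
    exact (Spec.map_comp _ _).symm
  have : GeometricallyIrreducible (hV.fromSpec ≫ X.C.hom) := by
    have : Nontrivial Γ(X.C.left, V) := hdom.toNontrivial
    have hne : Nonempty (Spec Γ(X.C.left, V)) := inferInstanceAs (Nonempty (PrimeSpectrum _))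
    have : Surjective (hV.fromSpec ≫ X.C.hom) := by
      refine ⟨fun y => ?_⟩
      obtain ⟨x⟩ := hne
      exact ⟨x, Subsingleton.elim (α := PrimeSpectrum F) _ _⟩
    infer_instance
  have hgeo : GeometricallyIrreducible (Spec.map (CommRingCat.ofHom
      (algebraMap F (Sections X.C V)))) := hmap ▸ this
  have : GeometricallyIrreducible (Limits.pullback.snd
      (Spec.map (CommRingCat.ofHom (algebraMap F (Sections X.C V))))
      (Spec.map (CommRingCat.ofHom (algebraMap F L)))) :=
    inferInstance
  have : Subsingleton (Spec (CommRingCat.of L)) := inferInstanceAs (Subsingleton (PrimeSpectrum L))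
  have : Nonempty (Spec (CommRingCat.of L)) := inferInstanceAs (Nonempty (PrimeSpectrum L))
  have hirr : IrreducibleSpace ↥(Limits.pullback
      (Spec.map (CommRingCat.ofHom (algebraMap F (Sections X.C V))))
      (Spec.map (CommRingCat.ofHom (algebraMap F L)))) :=
    GeometricallyIrreducible.irreducibleSpace_of_subsingleton (Limits.pullback.snd _ _)
  have hirr' : IrreducibleSpace (PrimeSpectrum (Sections X.C V ⊗[F] L)) :=
    (pullbackSpecIso F (Sections X.C V) L).hom.homeomorph.irreducibleSpace_iff.mp hirr
  rw [PrimeSpectrum.irreducibleSpace_iff_isPrime_nilradical, nilradical_eq_zero] at hirr'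
  have : (⊥ : Ideal (Sections X.C V ⊗[F] L)).IsPrime := hirr'
  exact IsDomain.of_bot_isPrime _

theorem isDomain_tensor {F : Type u} [Field F] [Fintype F]
    (X : PointedCurve F) (L : Type u) [Field L] [Algebra F L] :
    IsDomain (Sections X.C X.affinePart ⊗[F] L) := by
  obtain ⟨x⟩ := X.nonempty_affinePart
  obtain ⟨V, hV, hxV, hVU⟩ :=
    TopologicalSpace.Opens.isBasis_iff_nbhd.mp X.C.left.isBasis_affineOpens x.2
  replace hV : IsAffineOpen V := hV
  have : Nonempty V := ⟨⟨x.1, hxV⟩⟩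
  have := isDomain_tensor_affine X V hV L
  let r : Sections X.C X.affinePart →ₐ[F] Sections X.C V :=
    { toRingHom := (X.C.left.presheaf.map (homOfLE hVU).op).hom
      commutes' := fun c => by
        change (X.C.left.presheaf.map (homOfLE le_top).op ≫
          X.C.left.presheaf.map (homOfLE hVU).op).hom _ = _
        rw [← Functor.map_comp]
        rfl }
  have hr : Function.Injective r := map_injective_of_isIntegral X.C.left (homOfLE hVU)
  have hinj : Function.Injective (Algebra.TensorProduct.map r (AlgHom.id F L)) :=
    Module.Flat.rTensor_preserves_injective_linearMap r.toLinearMap hr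
  exact hinj.isDomain _

namespace PointedCurve

variable {F : Type u} [Field F] (X : PointedCurve F)

/-- The ring `A = Γ(C ∖ {∞}, 𝒪_C)` of functions regular outside `∞`. -/
abbrev A : Type u := Sections X.C X.affinePart

/-- The function field `K` of the curve. -/
def K : Type u := X.C.left.functionField

instance : Field X.K := inferInstanceAs (Field X.C.left.functionField)

variable [Fintype F]

/-- The inclusion of `A` in the function field. -/
def toK : X.A →+* X.K :=
  have := X.nonempty_affinePart
  (X.C.left.germToFunctionField X.affinePart).hom

instance : Algebra X.A X.K := X.toK.toAlgebra

instance : Algebra F X.K := (X.toK.comp (algebraMap F X.A)).toAlgebra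

instance (L : Type u) [Field L] [Algebra F L] : IsDomain (X.A ⊗[F] L) := isDomain_tensor X L

end PointedCurve

section GroupSchemes

variable (F : Type u) [Field F] (L : Type u) [Field L] [Algebra F L]

/-- An `F`-vector space scheme over `L`, through its functor of points: a functor from schemes over `L`
to `F`-vector spaces whose underlying functor to sets is representable by a scheme over `L`.
Morphisms of `F`-vector space schemes over `L` are the natural transformations. -/
structure VectorSpaceScheme where
  points : (Over (Spec (CommRingCat.of L)))ᵒᵖ ⥤ ModuleCat.{u} F
  isRepresentable : (points ⋙ forget (ModuleCat.{u} F)).IsRepresentable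

end GroupSchemes

section Ga

variable (F : Type u) [Field F] (L : Type u) [Field L] [Algebra F L]

/-- Pullback of global functions along a morphism of schemes over `R`. -/
def Sections.pullback {R F : Type u} [CommRing R] [CommRing F] [Algebra F R]
    {S T : Over (Spec (CommRingCat.of R))}
    (g : S ⟶ T) : Sections T ⊤ →ₐ[F] Sections S ⊤ :=
  { toRingHom := g.left.appTop.hom
    commutes' := fun c => by
      have h : T.hom.appTop ≫ g.left.appTop = S.hom.appTop := by
        rw [← Scheme.Hom.comp_appTop, Over.w]
      have h' := congr(($h).hom ((Scheme.ΓSpecIso (CommRingCat.of R)).inv.hom (algebraMap F R c)))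
      have e (T : Over (Spec (CommRingCat.of R))) : algebraMap F (Sections T ⊤) c =
          T.hom.appTop.hom ((Scheme.ΓSpecIso (CommRingCat.of R)).inv.hom (algebraMap F R c)) := by
        change (T.left.presheaf.map (𝟙 _)).hom _ = _
        rw [CategoryTheory.Functor.map_id]
        rfl
      rw [e, e]
      exact h' }

/-- The additive group over `L` as an `F`-vector space scheme: `𝔾ₐ(T) = Γ(T, 𝒪_T)`. -/
def Ga : (Over (Spec (CommRingCat.of L)))ᵒᵖ ⥤ ModuleCat.{u} F where
  obj T := ModuleCat.of F (Sections T.unop ⊤)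
  map g := ModuleCat.ofHom (Sections.pullback g.unop).toLinearMap
  map_id T := by
    ext s
    change (Scheme.Hom.appTop (𝟙 _)).hom s = s
    rw [Scheme.Hom.id_appTop]
    rfl
  map_comp g h := by
    ext s
    change (Scheme.Hom.appTop (h.unop.left ≫ g.unop.left)).hom s = _
    rw [Scheme.Hom.comp_appTop]
    rfl

instance {R F : Type u} [CommRing R] [CommRing F] [Algebra F R]
    (X : Over (Spec (CommRingCat.of R))) (U : X.left.Opens) :
    IsScalarTower F R (Sections X U) := .of_algebraMap_eq fun _ => rfl

namespace Ga

/-- Multiplication by a scalar `c ∈ L` on `𝔾ₐ`. -/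
def scalar : L →ₐ[F] End (Ga F L) where
  toFun c :=
    { app T := ModuleCat.ofHom
        ((LinearMap.lsmul L (Sections T.unop ⊤) c).restrictScalars F :
          Sections T.unop ⊤ →ₗ[F] Sections T.unop ⊤)
      naturality S T g := by
        refine ModuleCat.hom_ext (LinearMap.ext fun s => ?_)
        exact (map_smul (Sections.pullback (F := L) g.unop) c (show Sections S.unop ⊤ from s)).symm }
  map_one' := NatTrans.ext (funext fun T => ModuleCat.hom_ext (LinearMap.ext fun s =>
    one_smul L (show Sections T.unop ⊤ from s)))
  map_mul' a b := NatTrans.ext (funext fun T => ModuleCat.hom_ext (LinearMap.ext fun s =>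
    mul_smul a b (show Sections T.unop ⊤ from s)))
  map_zero' := NatTrans.ext (funext fun T => ModuleCat.hom_ext (LinearMap.ext fun s =>
    zero_smul L (show Sections T.unop ⊤ from s)))
  map_add' a b := NatTrans.ext (funext fun T => ModuleCat.hom_ext (LinearMap.ext fun s =>
    add_smul a b (show Sections T.unop ⊤ from s)))
  commutes' c := NatTrans.ext (funext fun T => ModuleCat.hom_ext (LinearMap.ext fun s =>
    algebraMap_smul L c (show Sections T.unop ⊤ from s)))

variable [Fintype F]

/-- The `q`-Frobenius `x ↦ x ^ q` of `𝔾ₐ`, where `q` is the number of elements of `F`. -/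
def frob : End (Ga F L) :=
  { app T := ModuleCat.ofHom (FiniteField.frobeniusAlgHom F (Sections T.unop ⊤)).toLinearMap
    naturality S T g := by
      refine ModuleCat.hom_ext (LinearMap.ext fun s => ?_)
      exact (map_pow (Sections.pullback (F := F) g.unop) (show Sections S.unop ⊤ from s) _).symm }

variable {F L} in
/-- `c` is the family of `τ`-coefficients of `ψ`: `ψ = ∑ c_n τ ^ n` in the ring `L{τ}` of `F`-linear
endomorphisms of `𝔾ₐ` over `L`, a finite sum. -/
def IsTauExpansion (ψ : End (Ga F L)) (c : ℕ →₀ L) : Prop :=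
  ψ = c.sum fun n x => scalar F L x * frob F L ^ n

end Ga
end Ga

section Lie

variable {F : Type u} [Field F] {L : Type u} [Field L] [Algebra F L]

/-- `Spec L[ε]` as a scheme over `L`. -/
def dualNumberPoint (L : Type u) [Field L] : Over (Spec (CommRingCat.of L)) :=
  Over.mk (Spec.map (CommRingCat.ofHom (algebraMap L (DualNumber L))))

/-- The closed immersion `Spec L → Spec L[ε]` given by `ε ↦ 0`. -/
def zeroPoint (L : Type u) [Field L] :
    Over.mk (𝟙 (Spec (CommRingCat.of L))) ⟶ dualNumberPoint L :=
  Over.homMk (Spec.map (CommRingCat.ofHom (TrivSqZeroExt.fstHom L L L).toRingHom)) (by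
    change Spec.map _ ≫ Spec.map _ = 𝟙 _
    rw [← Spec.map_comp, ← CommRingCat.ofHom_comp]
    have : (TrivSqZeroExt.fstHom L L L).toRingHom.comp (algebraMap L (DualNumber L)) =
      RingHom.id L := by ext; rfl
    erw [this]
    exact Spec.map_id _)

/-- The endomorphism of `Spec L[ε]` over `L` given by `ε ↦ c ε`. -/
def scalePoint (c : L) : dualNumberPoint L ⟶ dualNumberPoint L :=
  Over.homMk (Spec.map (CommRingCat.ofHom
    (TrivSqZeroExt.map (c • (LinearMap.id : L →ₗ[L] L))).toRingHom)) (by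
    change Spec.map _ ≫ Spec.map _ = Spec.map _
    rw [← Spec.map_comp, ← CommRingCat.ofHom_comp]
    congr 2
    ext x
    · simp
    · simp)

theorem zeroPoint_scalePoint (c : L) : zeroPoint L ≫ scalePoint c = zeroPoint L := by
  ext1
  change Spec.map _ ≫ Spec.map _ = Spec.map _
  rw [← Spec.map_comp, ← CommRingCat.ofHom_comp]
  congr 2
  ext x
  · simp
  · simp

namespace VectorSpaceScheme

variable (E : VectorSpaceScheme F L)

/-- The Lie algebra of `E` over `L`: the kernel of `E(L[ε]) → E(L)`, `ε ↦ 0`. -/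
def Lie : Submodule F (E.points.obj (op (dualNumberPoint L))) :=
  LinearMap.ker (E.points.map (zeroPoint L).op).hom

/-- The endomorphism `∂ψ` of the Lie algebra induced by an endomorphism `ψ` of `E`. -/
def lieMap (ψ : End E.points) : Module.End F E.Lie :=
  (ψ.app (op (dualNumberPoint L))).hom.restrict fun x hx => by
    have h := congr(($(ψ.naturality (zeroPoint L).op)).hom x)
    change _ = 0
    change (E.points.map (zeroPoint L).op).hom x = 0 at hx
    have h' : (ψ.app _).hom ((E.points.map (zeroPoint L).op).hom x) =
      (E.points.map (zeroPoint L).op).hom ((ψ.app _).hom x) := h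
    rw [← h', hx, map_zero]

/-- Scalar multiplication by `c ∈ L` on the Lie algebra, induced by `ε ↦ c ε`. -/
def lieScalar (c : L) : Module.End F E.Lie :=
  (E.points.map (scalePoint c).op).hom.restrict fun x hx => by
    change (E.points.map (zeroPoint L).op).hom ((E.points.map (scalePoint c).op).hom x) = 0
    change (E.points.map (zeroPoint L).op).hom x = 0 at hx
    rw [← LinearMap.comp_apply, ← ModuleCat.hom_comp, ← Functor.map_comp, ← op_comp,
      zeroPoint_scalePoint, hx]

end VectorSpaceScheme

end Lie

section Anderson

variable {F : Type u} [Field F] [Fintype F]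

/-- An Anderson `A`-module of dimension `d` over an extension field `L` of `K`: an `F`-vector space scheme
`E` over `L` that is isomorphic to `𝔾ₐ ^ d`, with a homomorphism `φ` of `F`-algebras from `A` to the
endomorphisms of `E`, such that `∂φ_a - a` is nilpotent on the Lie algebra for all `a ∈ A`. -/
structure AndersonModule (X : PointedCurve F) (L : Type u) [Field L] [Algebra F L]
    [Algebra X.K L] [IsScalarTower F X.K L] (d : ℕ) extends VectorSpaceScheme F L where
  iso_Ga_pow : Nonempty (points ≅ ∏ᶜ fun _ : Fin d => Ga F L)
  phi : X.A →ₐ[F] End points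
  isNilpotent : ∀ a : X.A, IsNilpotent (toVectorSpaceScheme.lieMap (phi a) -
    toVectorSpaceScheme.lieScalar (algebraMap X.K L (algebraMap X.A X.K a)))

namespace AndersonModule

variable {X : PointedCurve F} {L : Type u} [Field L] [Algebra F L]
    [Algebra X.K L] [IsScalarTower F X.K L] {d : ℕ} (E : AndersonModule X L d)

/-- The `A`-motive `M(E)`: the homomorphisms of `F`-vector space schemes from `E` to `𝔾ₐ`. -/
def Motive : Type _ := E.points ⟶ Ga F L

instance : AddCommGroup E.Motive := inferInstanceAs (AddCommGroup (E.points ⟶ Ga F L))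

instance : Module F E.Motive := inferInstanceAs (Module F (E.points ⟶ Ga F L))

/-- The action of `A` on the motive: `a · m = m ∘ φ_a`. -/
def actA : X.A →ₐ[F] Module.End F E.Motive where
  toFun a := Linear.leftComp F (Ga F L) (E.phi a)
  map_one' := by
    refine LinearMap.ext fun m => ?_
    change E.phi 1 ≫ (m : E.points ⟶ Ga F L) = m
    rw [map_one]
    exact Category.id_comp _
  map_mul' a b := by
    refine LinearMap.ext fun m => ?_
    change E.phi (a * b) ≫ (m : E.points ⟶ Ga F L) = E.phi a ≫ E.phi b ≫ m
    rw [mul_comm, map_mul, End.mul_def, Category.assoc]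
  map_zero' := by
    refine LinearMap.ext fun m => ?_
    change E.phi 0 ≫ (m : E.points ⟶ Ga F L) = 0
    rw [map_zero]
    exact Limits.zero_comp
  map_add' a b := by
    refine LinearMap.ext fun m => ?_
    change E.phi (a + b) ≫ (m : E.points ⟶ Ga F L) = E.phi a ≫ m + E.phi b ≫ m
    rw [map_add]
    exact Preadditive.add_comp _ _ _ _ _ _
  commutes' c := by
    refine LinearMap.ext fun m => ?_
    change E.phi (algebraMap F X.A c) ≫ (m : E.points ⟶ Ga F L) = c • m
    rw [AlgHom.commutes, Algebra.algebraMap_eq_smul_one]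
    exact (Linear.smul_comp _ _ _ _ _ _).trans (congrArg _ (Category.id_comp _))

/-- The action of `L` on the motive: `c · m` is `m` followed by multiplication by `c`. -/
def actL : L →ₐ[F] Module.End F E.Motive where
  toFun c := Linear.rightComp F E.points (Ga.scalar F L c)
  map_one' := by
    refine LinearMap.ext fun m => ?_
    change (m : E.points ⟶ Ga F L) ≫ Ga.scalar F L 1 = m
    rw [map_one]
    exact Category.comp_id _
  map_mul' a b := by
    refine LinearMap.ext fun m => ?_
    change (m : E.points ⟶ Ga F L) ≫ Ga.scalar F L (a * b) =
      (m ≫ Ga.scalar F L b) ≫ Ga.scalar F L a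
    rw [map_mul, End.mul_def, Category.assoc]
  map_zero' := by
    refine LinearMap.ext fun m => ?_
    change (m : E.points ⟶ Ga F L) ≫ Ga.scalar F L 0 = 0
    rw [map_zero]
    exact Limits.comp_zero
  map_add' a b := by
    refine LinearMap.ext fun m => ?_
    change (m : E.points ⟶ Ga F L) ≫ Ga.scalar F L (a + b) =
      m ≫ Ga.scalar F L a + m ≫ Ga.scalar F L b
    rw [map_add]
    exact Preadditive.comp_add _ _ _ _ _ _
  commutes' c := by
    refine LinearMap.ext fun m => ?_
    change (m : E.points ⟶ Ga F L) ≫ Ga.scalar F L (algebraMap F L c) = c • m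
    rw [AlgHom.commutes, Algebra.algebraMap_eq_smul_one]
    exact (Linear.comp_smul _ _ _ _ _ _).trans (congrArg _ (Category.comp_id _))

/-- The motive as a module over `A ⊗ L`. -/
instance : Module (X.A ⊗[F] L) E.Motive :=
  Module.compHom _ (Algebra.TensorProduct.lift E.actA E.actL fun a c =>
    LinearMap.ext fun m => Category.assoc (E.phi a) m (Ga.scalar F L c)).toRingHom

/-- `E` is abelian: its motive is finitely generated over `A ⊗ L`. -/
def IsAbelian : Prop := Module.Finite (X.A ⊗[F] L) E.Motive

/-- The rank of `E`: the rank of its motive over the domain `A ⊗ L`, that is, the dimension of the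
motive tensored with the fraction field (for abelian `E` the motive is locally free, of this
rank). -/
def rank : ℕ := Module.finrank (X.A ⊗[F] L) E.Motive

/-- A Drinfeld-Hayes module: an abelian Anderson `A`-module of dimension one and rank one. -/
structure IsDrinfeldHayes (E : AndersonModule X L 1) : Prop where
  isAbelian : E.IsAbelian
  rank_eq_one : E.rank = 1

/-- The semilinear action of `τ` on the motive: composition `m ↦ Frob_q ∘ m` with the `q`-Frobenius
of the additive group. -/
def frobMotive (m : E.Motive) : E.Motive := (m : E.points ⟶ Ga F L) ≫ Ga.frob F L

end AndersonModule
end Anderson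

section Shtuka

variable {F : Type u} [Field F] [Fintype F] (X : PointedCurve F)
    (L : Type u) [Field L] [Algebra F L]

/-- The fraction field of the domain `A ⊗ L`. -/
abbrev FractionField : Type u := FractionRing (X.A ⊗[F] L)

/-- The Frobenius twist `a ⊗ x ↦ a ⊗ x ^ q` of `A ⊗ L`. -/
def twistTensor : X.A ⊗[F] L →ₐ[F] X.A ⊗[F] L :=
  Algebra.TensorProduct.map (AlgHom.id F X.A) (FiniteField.frobeniusAlgHom F L)

theorem twistTensor_injective : Function.Injective (twistTensor X L) :=
  Module.Flat.lTensor_preserves_injective_linearMap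
    (FiniteField.frobeniusAlgHom F L).toLinearMap
    (RingHom.injective (FiniteField.frobeniusAlgHom F L).toRingHom)

/-- The Frobenius twist `f ↦ f⁽¹⁾` of the fraction field of `A ⊗ L`. -/
def twist : FractionField X L →+* FractionField X L :=
  IsFractionRing.map (j := (twistTensor X L).toRingHom) (twistTensor_injective X L)

namespace AndersonModule
variable {X L} [Algebra X.K L] [IsScalarTower F X.K L] (E : AndersonModule X L 1)

/-- A coordinate `κ : E ≅ 𝔾ₐ` seen as an element of the motive. -/
def coord (κ : E.points ≅ Ga F L) : E.Motive := κ.hom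

/-- `f` is a shtuka function of `E` associated to `κ`: an element of the fraction field of `A ⊗ L`
such that `Frob_q ∘ κ = f · κ`, an identity in `Frac(A ⊗ L) ⊗ M(E)`. -/
def IsShtukaFunction (κ : E.points ≅ Ga F L) (f : FractionField X L) : Prop :=
  (1 : FractionField X L) ⊗ₜ[X.A ⊗[F] L] E.frobMotive (E.coord κ) =
    f • ((1 : FractionField X L) ⊗ₜ[X.A ⊗[F] L] E.coord κ)

/-- The endomorphism `φ_a` of `E` transported to `𝔾ₐ` by the coordinate `κ`, that is
`κ ∘ φ_a ∘ κ⁻¹`. -/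
def phiCoord (κ : E.points ≅ Ga F L) (a : X.A) : End (Ga F L) := κ.inv ≫ E.phi a ≫ κ.hom

end AndersonModule
end Shtuka

end DrinfeldHayes

end

open DrinfeldHayes

/-! The representing object of `𝔾ₐ` is `Spec L[X]`, so by Yoneda an endomorphism is a polynomial,
read off at the tautological point. Additivity and compatibility with scalars in `F` leave only the
monomials `X ^ q ^ n`; hence the endomorphism ring is `L{τ}`, and coefficients are unique
(`Ga.exists_isTauExpansion`, `Ga.IsTauExpansion.unique`).

Through `κ`, every element of the motive is therefore an `L`-combination of the `τ ^ n ∘ κ`.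
Composition with Frobenius is semilinear for the twist of `A ⊗ L`, so it preserves torsion. If `κ`
were torsion, the whole motive would be torsion, contradicting rank one (`tmul_coord_ne_zero`). Thus
`κ` is a basis of the one-dimensional space `Frac(A ⊗ L) ⊗ M`, and the coefficient of `τ ∘ κ` in
this basis is the shtuka function `f`.

Semilinearity turns `τ ∘ κ = f κ` into `τ ^ n ∘ κ = f⁽ⁿ⁻¹⁾ ⋯ f⁽¹⁾ f κ` (`tmul_frobMotive_iterate`).
Finally, `a · κ = κ ∘ φ_a` equals `∑ (a)_n τ ^ n ∘ κ`, and comparing coefficients of `κ` gives the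
identity. -/

noncomputable section

/-! ### Additive polynomials over an extension of a finite field. -/

/-- An exponent `i` such that `x ↦ x ^ i` is additive in characteristic `p` and is the identity on a
finite field with `q` elements is a power of `q`. -/
theorem exists_eq_card_pow_of_choose_eq_zero (F : Type*) [Field F] [Fintype F]
    {L : Type*} [Field L] [Algebra F L] {i : ℕ} (hi : i ≠ 0)
    (hchoose : ∀ j, 0 < j → j < i → (i.choose j : L) = 0) (hpow : ∀ c : F, c ^ i = c) :
    ∃ n, i = Fintype.card F ^ n := by
  obtain ⟨p, hF⟩ := CharP.exists F
  obtain ⟨⟨f, hf⟩, hp, hcard⟩ := FiniteField.card F p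
  have : Fact p.Prime := ⟨hp⟩
  have : CharP L p := charP_of_injective_algebraMap (algebraMap F L).injective p
  obtain ⟨k, j, hj, rfl⟩ := Nat.exists_eq_pow_mul_and_not_dvd hi p hp.ne_one
  have hX : ((Polynomial.X : Polynomial L) + 1) ^ (p ^ k * j) = Polynomial.X ^ (p ^ k * j) + 1 := by
    ext m
    rw [Polynomial.coeff_X_add_one_pow, Polynomial.coeff_add, Polynomial.coeff_X_pow,
      Polynomial.coeff_one]
    rcases Nat.eq_zero_or_pos m with rfl | hm
    · simp [hi.symm]
    rcases lt_trichotomy m (p ^ k * j) with h | rfl | h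
    · simp [hchoose m hm h, hm.ne', h.ne]
    · simp [hi]
    · simp [Nat.choose_eq_zero_of_lt h, hm.ne', h.ne']
  -- The `p ^ k`-th power of the difference of the two sides vanishes by `hX`, and `L[X]` is
  -- reduced.
  have hX' : ((Polynomial.X : Polynomial L) + 1) ^ j = Polynomial.X ^ j + 1 := by
    rw [← sub_eq_zero]
    refine eq_zero_of_pow_eq_zero (n := p ^ k) ?_
    rw [sub_pow_char_pow, add_pow_char_pow, ← pow_mul, ← pow_mul, mul_comm j, hX, one_pow, sub_self]
  -- Otherwise the coefficient of `X` gives `j = 0` in `L`, although `p` does not divide `j`.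
  have hj1 : j = 1 := by
    by_contra hne
    have h := congrArg (fun P => Polynomial.coeff P 1) hX'
    simp only [Polynomial.coeff_X_add_one_pow, Polynomial.coeff_add, Polynomial.coeff_X_pow,
      Polynomial.coeff_one, Nat.choose_one_right] at h
    rw [if_neg (Ne.symm hne), if_neg one_ne_zero, add_zero, CharP.cast_eq_zero_iff L p] at h
    exact hj h
  subst hj1
  rw [mul_one] at hpow ⊢
  -- Since `q = p ^ f` and `c ^ q = c`, only `k` modulo `f` matters.
  have hr : ∀ c : F, c ^ p ^ (k % f) = c := fun c => by
    conv_rhs => rw [← hpow c, ← Nat.div_add_mod k f, pow_add, pow_mul p f]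
    rw [pow_mul, ← show Fintype.card F = p ^ f from hcard, FiniteField.pow_card_pow]
  have hr0 : k % f = 0 := by
    by_contra hne
    have hlt : p ^ (k % f) < Fintype.card F := by
      rw [hcard]
      exact Nat.pow_lt_pow_right hp.one_lt (Nat.mod_lt k hf)
    have h1 : 1 < p ^ (k % f) := Nat.one_lt_pow hne hp.one_lt
    -- Every unit of `F` is killed by `p ^ (k % f) - 1`, so this positive number is a multiple of `q
    -- - 1`, yet it is smaller than `q - 1`.
    have hd : Fintype.card F - 1 ∣ p ^ (k % f) - 1 :=
      (FiniteField.forall_pow_eq_one_iff F _).mp fun x => by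
        ext
        refine mul_right_cancel₀ x.ne_zero ?_
        rw [Units.val_pow_eq_pow_val, ← pow_succ, Nat.sub_add_cancel h1.le, hr, Units.val_one,
          one_mul]
    have := Nat.le_of_dvd (by omega) hd
    omega
  refine ⟨k / f, ?_⟩
  rw [hcard, ← pow_mul]
  exact congrArg _ (Nat.mul_div_cancel' (Nat.dvd_of_mod_eq_zero hr0)).symm

namespace Polynomial

/-- The Hasse derivatives of an additive polynomial are constant. -/
theorem hasseDeriv_eq_C_of_additive {L : Type*} [CommRing L] {P : Polynomial L}
    (hadd : aeval (C X + X : Polynomial (Polynomial L)) P = aeval (C X) P + aeval X P)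
    {n : ℕ} (hn : n ≠ 0) : hasseDeriv n P = C (P.coeff n) := by
  -- In `L[X][Y]` the inner variable is `C X` and the outer one is `Y`. The coefficient of `Y ^ n`
  -- in `P(X + Y)` is the `n`-th Hasse derivative of `P`; in `P(X) + P(Y)` it is the constant
  -- `P.coeff n`.
  have h1 : aeval (C X + X : Polynomial (Polynomial L)) P = taylor X (P.map C) := by
    rw [taylor_apply, comp, eval₂_map, aeval_def, add_comm]
    rfl
  have h2 : aeval (X : Polynomial (Polynomial L)) P = P.map C := by
    rw [aeval_def, map]
    rfl
  have h3 : aeval (C X : Polynomial (Polynomial L)) P = C P := by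
    have := aeval_algHom_apply (CAlgHom (R := L) (A := Polynomial L)) X P
    rw [aeval_X_left_apply] at this
    exact this
  have h := congrArg (fun Q => coeff Q n) hadd
  simp only [h1, h2, h3, taylor_coeff, coeff_add, coeff_C, if_neg hn, zero_add, coeff_map] at h
  have h4 : hasseDeriv n (P.map C) = (hasseDeriv n P).map C := by
    ext : 1
    simp [hasseDeriv_coeff]
  rw [← h, h4, eval_map]
  exact (eval₂_C_X).symm

theorem coeff_sum_X_pow_card_pow (F : Type*) [Field F] [Fintype F]
    {L : Type*} [Field L] (c : ℕ →₀ L) (n : ℕ) :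
    (c.sum fun n x => C x * X ^ Fintype.card F ^ n : Polynomial L).coeff (Fintype.card F ^ n) =
      c n := by
  rw [Finsupp.sum, finsetSum_coeff, Finset.sum_eq_single n]
  · simp
  · intro m _ hm
    rw [coeff_C_mul_X_pow, if_neg]
    exact fun h => hm (Nat.pow_right_injective Fintype.one_lt_card h).symm
  · simp +contextual

/-- Additive polynomials compatible with the scalars in `F` are polynomials in the Frobenius. -/
theorem exists_eq_sum_X_pow_card_pow (F : Type*) [Field F] [Fintype F]
    {L : Type*} [Field L] [Algebra F L] {P : Polynomial L}
    (hadd : aeval (C X + X : Polynomial (Polynomial L)) P = aeval (C X) P + aeval X P)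
    (hsmul : ∀ c : F, aeval (c • X : Polynomial L) P = c • P) :
    ∃ c : ℕ →₀ L, P = c.sum fun n x => C x * X ^ Fintype.card F ^ n := by
  have hsmul' : ∀ (c : F) (i : ℕ), P.coeff i * algebraMap F L c ^ i =
      algebraMap F L c * P.coeff i := fun c i => by
    have h := congrArg (fun Q => coeff Q i) (hsmul c)
    simp only [← algebraMap_smul L c, coeff_smul, smul_eq_mul] at h
    rw [← h, smul_eq_C_mul, ← comp_eq_aeval, comp_C_mul_X_coeff]
  have hsupp : ∀ i, P.coeff i ≠ 0 → ∃ n, i = Fintype.card F ^ n := fun i hi => by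
    have hpow : ∀ c : F, c ^ i = c := fun c => by
      apply (algebraMap F L).injective
      rw [map_pow]
      exact mul_left_cancel₀ hi ((hsmul' c i).trans (mul_comm _ _))
    refine exists_eq_card_pow_of_choose_eq_zero F (L := L) ?_ (fun j hj hji => ?_) hpow
    · rintro rfl
      simpa using hpow 0
    -- The coefficient of `X ^ (i - j)` in the `j`-th Hasse derivative is `i.choose j * P.coeff i`;
    -- it vanishes because that derivative is constant and `i - j > 0`.
    · have h := congrArg (fun Q => coeff Q (i - j)) (hasseDeriv_eq_C_of_additive hadd hj.ne')
      simp only [hasseDeriv_coeff, coeff_C, if_neg (Nat.sub_ne_zero_of_lt hji),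
        Nat.sub_add_cancel hji.le] at h
      exact (mul_eq_zero.mp h).resolve_right hi
  -- The range suffices because `n < q ^ n ≤ P.natDegree` whenever the coefficient of `X ^ q ^ n` is
  -- nonzero.
  refine ⟨Finsupp.onFinset (Finset.range (P.natDegree + 1))
    (fun n => P.coeff (Fintype.card F ^ n)) fun n hn => Finset.mem_range_succ_iff.mpr
      ((Nat.lt_pow_self Fintype.one_lt_card).le.trans (le_natDegree_of_ne_zero hn)), ?_⟩
  ext i
  by_cases hi : ∃ n, i = Fintype.card F ^ n
  · obtain ⟨n, rfl⟩ := hi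
    rw [coeff_sum_X_pow_card_pow]
    rfl
  · rw [not_not.mp (mt (hsupp i) hi), Finsupp.sum, finsetSum_coeff, Finset.sum_eq_zero]
    exact fun n _ => by rw [coeff_C_mul_X_pow, if_neg fun h => hi ⟨n, h⟩]

end Polynomial
-- Points of affine schemes and the endomorphism ring of `𝔾ₐ`.
namespace DrinfeldHayes

section Points

variable {L : Type u} [CommRing L]

/-- `Spec B` as a scheme over `Spec L`. -/
def specOver (L : Type u) [CommRing L] (B : Type u) [CommRing B] [Algebra L B] :
    Over (Spec (CommRingCat.of L)) :=
  Over.mk (Spec.map (CommRingCat.ofHom (algebraMap L B)))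

theorem Sections.algebraMap_top_apply (T : Over (Spec (CommRingCat.of L))) (c : L) :
    algebraMap L (Sections T ⊤) c =
      T.hom.appTop.hom ((Scheme.ΓSpecIso (CommRingCat.of L)).inv.hom c) := by
  change (T.left.presheaf.map (𝟙 _)).hom _ = _
  rw [CategoryTheory.Functor.map_id]
  rfl

/-- The global functions on `Spec B` are `B`. -/
def specSections (B : Type u) [CommRing B] [Algebra L B] :
    B ≃ₐ[L] Sections (specOver L B) ⊤ :=
  AlgEquiv.ofRingEquiv
    (f := (Scheme.ΓSpecIso (CommRingCat.of B)).symm.commRingCatIsoToRingEquiv) fun c => by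
      rw [Sections.algebraMap_top_apply]
      exact congr(($(Scheme.ΓSpecIso_inv_naturality
        (CommRingCat.ofHom (algebraMap L B)))).hom c)

/-- A morphism to `Spec B` is given by its effect on functions. -/
theorem exists_pullback_eq {T : Over (Spec (CommRingCat.of L))} {B : Type u} [CommRing B]
    [Algebra L B] (φ : B →ₐ[L] Sections T ⊤) :
    ∃ g : T ⟶ specOver L B, ∀ b, Sections.pullback (F := L) g (specSections B b) = φ b := by
  let φ' : CommRingCat.of B ⟶ Γ(T.left, ⊤) := CommRingCat.ofHom φ.toRingHom
  have hφ : CommRingCat.ofHom (algebraMap L B) ≫ φ' =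
      (Scheme.ΓSpecIso (CommRingCat.of L)).inv ≫ T.hom.appTop := by
    ext c
    exact (φ.commutes c).trans (Sections.algebraMap_top_apply T c)
  refine ⟨Over.homMk (T.left.toSpecΓ ≫ Spec.map φ') ?_, fun b => ?_⟩
  · change (T.left.toSpecΓ ≫ Spec.map φ') ≫ Spec.map (CommRingCat.ofHom (algebraMap L B)) = T.hom
    rw [Category.assoc, ← Spec.map_comp, hφ, Spec.map_comp, ← Scheme.toSpecΓ_naturality_assoc,
      toSpecΓ_SpecMap_ΓSpecIso_inv, Category.comp_id]
  · change ((Scheme.ΓSpecIso (CommRingCat.of B)).inv ≫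
      (T.left.toSpecΓ ≫ Spec.map φ').appTop).hom b = φ b
    rw [Scheme.Hom.comp_appTop, ← Scheme.ΓSpecIso_inv_naturality_assoc, Scheme.toSpecΓ_appTop,
      Iso.inv_hom_id, Category.comp_id]
    rfl

end Points

namespace Ga

variable {F : Type u} [Field F] {L : Type u} [Field L] [Algebra F L]

/-- The action of an endomorphism of `𝔾ₐ` on `T`-valued points. -/
def onSections (ψ : End (Ga F L)) (T : Over (Spec (CommRingCat.of L))) :
    Sections T ⊤ →ₗ[F] Sections T ⊤ :=
  (ψ.app (op T)).hom

theorem onSections_pullback (ψ : End (Ga F L)) {S T : Over (Spec (CommRingCat.of L))} (g : S ⟶ T)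
    (s : Sections T ⊤) :
    onSections ψ S (Sections.pullback (F := L) g s) =
      Sections.pullback (F := L) g (onSections ψ T s) :=
  congr(($(ψ.naturality g.op)).hom s)

theorem ext_onSections {ψ χ : End (Ga F L)} (h : ∀ T s, onSections ψ T s = onSections χ T s) :
    ψ = χ :=
  NatTrans.ext (funext fun T => ModuleCat.hom_ext (LinearMap.ext fun s => h T.unop s))

/-- Every endomorphism of `𝔾ₐ` is given by a polynomial. -/
theorem exists_onSections_eq_aeval (ψ : End (Ga F L)) :
    ∃ P : Polynomial L, ∀ T s, onSections ψ T s = Polynomial.aeval s P := by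
  -- The tautological point of the affine line: every section `s` over `T` is its pullback along the
  -- map classified by `X ↦ s`, so naturality determines `ψ` from its value here.
  let x : Sections (specOver L (Polynomial L)) ⊤ := specSections (L := L) (Polynomial L) Polynomial.X
  obtain ⟨P, hP⟩ := (specSections (L := L) (Polynomial L)).surjective (onSections ψ _ x)
  refine ⟨P, fun T s => ?_⟩
  obtain ⟨g, hg⟩ := exists_pullback_eq (Polynomial.aeval (R := L) s)
  have := onSections_pullback ψ g x
  rw [hg, Polynomial.aeval_X, ← hP, hg] at this
  exact this

variable [Fintype F]

theorem onSections_sum (c : ℕ →₀ L) (T : Over (Spec (CommRingCat.of L))) (s : Sections T ⊤) :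
    onSections (c.sum fun n x => scalar F L x * frob F L ^ n) T s =
      Polynomial.aeval s
        (c.sum fun n x => Polynomial.C x * Polynomial.X ^ Fintype.card F ^ n : Polynomial L) := by
  have hfrob : ∀ n, onSections (frob F L ^ n) T s = s ^ Fintype.card F ^ n := fun n => by
    induction n with
    | zero =>
      rw [pow_zero, pow_zero, pow_one]
      rfl
    | succ n ih =>
      rw [pow_succ', pow_succ, pow_mul, ← ih]
      rfl
  let ev : End (Ga F L) →+ Sections T ⊤ :=
    { toFun ψ := onSections ψ T s
      map_zero' := rfl
      map_add' _ _ := rfl }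
  change ev _ = _
  rw [map_finsuppSum, map_finsuppSum]
  refine Finsupp.sum_congr fun n _ => ?_
  rw [map_mul (Polynomial.aeval s), map_pow, Polynomial.aeval_C, Polynomial.aeval_X, ← hfrob, ← Algebra.smul_def]
  rfl

/-- The endomorphism ring of `𝔾ₐ` is the ring `L{τ}` of polynomials in the Frobenius. -/
theorem exists_isTauExpansion (ψ : End (Ga F L)) : ∃ c, IsTauExpansion ψ c := by
  obtain ⟨P, hP⟩ := exists_onSections_eq_aeval ψ
  -- Evaluating `P` in `B` is the action of `ψ` on `B`-points. Additivity is then tested in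
  -- `L[X][Y]` and homogeneity over `F` in `L[X]`, where they become polynomial identities.
  have hB : ∀ (B : Type u) [CommRing B] [Algebra L B] (b : B),
      specSections B (Polynomial.aeval b P) = onSections ψ (specOver L B) (specSections B b) :=
    fun B _ _ b => by rw [hP]; exact (Polynomial.aeval_algHom_apply (specSections B) b P).symm
  obtain ⟨c, hc⟩ := Polynomial.exists_eq_sum_X_pow_card_pow F (P := P)
    (by
      apply (specSections (L := L) (Polynomial (Polynomial L))).injective
      rw [hB, map_add, map_add, map_add, hB, hB])
    (fun c => by
      apply (specSections (L := L) (Polynomial L)).injective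
      rw [hB, ← algebraMap_smul L c (Polynomial.X : Polynomial L), map_smul, algebraMap_smul,
        map_smul, ← hB, Polynomial.aeval_X_left_apply, ← algebraMap_smul L c, ← algebraMap_smul L c,
        map_smul])
  refine ⟨c, ext_onSections fun T s => ?_⟩
  rw [hP, onSections_sum, ← hc]

theorem IsTauExpansion.unique {ψ : End (Ga F L)} {c d : ℕ →₀ L} (hc : IsTauExpansion ψ c)
    (hd : IsTauExpansion ψ d) : c = d := by
  let x : Sections (specOver L (Polynomial L)) ⊤ := specSections (L := L) (Polynomial L) Polynomial.X
  have haev : ∀ P : Polynomial L, Polynomial.aeval x P = specSections (Polynomial L) P := fun P =>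
    (Polynomial.aeval_algHom_apply (specSections (L := L) (Polynomial L)) Polynomial.X P).trans
      (by rw [Polynomial.aeval_X_left_apply])
  have h := congrArg (fun χ => onSections χ _ x) (hc.symm.trans hd)
  simp only [onSections_sum, haev, EmbeddingLike.apply_eq_iff_eq] at h
  ext n
  rw [← Polynomial.coeff_sum_X_pow_card_pow F c, h, Polynomial.coeff_sum_X_pow_card_pow]

end Ga
end DrinfeldHayes

/-! ### Semilinear maps after passage to the fraction field. -/

theorem eq_of_smul_eq_smul_of_ne_zero {K V : Type*} [Field K] [AddCommGroup V] [Module K V]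
    {v : V} (hv : v ≠ 0) {a b : K} (h : a • v = b • v) : a = b :=
  smul_left_injective K hv h

section Semilinear

open nonZeroDivisors

variable {R : Type*} [CommRing R] [IsDomain R] {M : Type*} [AddCommGroup M] [Module R M]
  {K : Type*} [Field K] [Algebra R K] [IsFractionRing R K]

theorem tmul_eq_zero_iff_exists_smul_eq_zero (m : M) :
    (1 : K) ⊗ₜ[R] m = 0 ↔ ∃ r : R, r ≠ 0 ∧ r • m = 0 := by
  have := IsLocalizedModule.eq_zero_iff R⁰ (TensorProduct.mk R K M 1) (m := m)
  simp only [TensorProduct.mk_apply] at this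
  rw [this]
  exact ⟨fun ⟨s, hs⟩ => ⟨s, nonZeroDivisors.ne_zero s.2, hs⟩,
    fun ⟨r, hr, h⟩ => ⟨⟨r, mem_nonZeroDivisors_of_ne_zero hr⟩, h⟩⟩

/-- Over a fraction field, a semilinear map acts on coefficients by the twist. -/
theorem tmul_eq_smul_of_semilinear {σ : R →+* R} (hσ : Function.Injective σ) {τ : M →ₛₗ[σ] M}
    {m n : M} {g : K} (h : (1 : K) ⊗ₜ[R] m = g • ((1 : K) ⊗ₜ[R] n)) :
    (1 : K) ⊗ₜ[R] τ m = IsFractionRing.map (K := K) (L := K) (j := σ) hσ g • ((1 : K) ⊗ₜ[R] τ n) := by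
  obtain ⟨p, r, hr, rfl⟩ := IsFractionRing.div_surjective (A := R) g
  have hr0 : r ≠ 0 := nonZeroDivisors.ne_zero hr
  have hK : ∀ {s : R}, s ≠ 0 → algebraMap R K s ≠ 0 := fun hs =>
    (map_ne_zero_iff _ (IsFractionRing.injective R K)).mpr hs
  -- Clearing denominators turns a relation with a fractional coefficient into the vanishing of an
  -- element coming from `M`, that is, into a torsion statement to which `τ` can be applied.
  have key : ∀ (s t : R) (x y : M), s ≠ 0 → ((1 : K) ⊗ₜ[R] x =
      (algebraMap R K t / algebraMap R K s) • ((1 : K) ⊗ₜ[R] y) ↔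
        (1 : K) ⊗ₜ[R] (s • x - t • y) = 0) := fun s t x y hs => by
    rw [TensorProduct.tmul_sub, sub_eq_zero, TensorProduct.tmul_smul, TensorProduct.tmul_smul,
      ← algebraMap_smul K s, ← algebraMap_smul K t, div_eq_inv_mul, mul_smul, eq_inv_smul_iff₀ (hK hs)]
  rw [key r p m n hr0, tmul_eq_zero_iff_exists_smul_eq_zero] at h
  obtain ⟨s, hs, h⟩ := h
  rw [map_div₀, IsFractionRing.map, IsLocalization.map_eq, IsLocalization.map_eq,
    key _ _ _ _ ((map_ne_zero_iff σ hσ).mpr hr0), tmul_eq_zero_iff_exists_smul_eq_zero]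
  -- Applying `τ` to a torsion relation twists its annihilator; injectivity of `σ` keeps it nonzero.
  refine ⟨σ s, (map_ne_zero_iff σ hσ).mpr hs, ?_⟩
  have := congrArg τ h
  rwa [map_smulₛₗ, map_sub, map_smulₛₗ, map_smulₛₗ, map_zero] at this

end Semilinear

/-! ### The motive, its Frobenius and the shtuka function. -/

namespace DrinfeldHayes
namespace AndersonModule

variable {F : Type u} [Field F] [Fintype F] {X : PointedCurve F} {L : Type u} [Field L]
  [Algebra F L] [Algebra X.K L] [IsScalarTower F X.K L] {d : ℕ}

section
variable (E : AndersonModule X L d)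

theorem tmul_smul_motive (a : X.A) (l : L) (m : E.Motive) :
    (a ⊗ₜ[F] l) • m = E.actA a (E.actL l m) :=
  congr($(Algebra.TensorProduct.lift_tmul E.actA E.actL (fun a c =>
    LinearMap.ext fun m => Category.assoc (E.phi a) m (Ga.scalar F L c)) a l) m)

/-- Composition with the Frobenius is semilinear on the motive. -/
def frobSemilinear : E.Motive →ₛₗ[(twistTensor X L).toRingHom] E.Motive where
  toFun := E.frobMotive
  map_add' m n := Preadditive.add_comp _ _ _ (m : E.points ⟶ Ga F L) n (Ga.frob F L)
  map_smul' r m := by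
    induction r with
    | zero =>
      rw [zero_smul, map_zero, zero_smul]
      exact Limits.zero_comp
    | add r s hr hs =>
      rw [add_smul, map_add, add_smul, ← hr, ← hs]
      exact Preadditive.add_comp _ _ _ (r • m : E.Motive) (s • m : E.Motive) (Ga.frob F L)
    | tmul a l =>
      -- The relation `τ l = l ^ q τ` of `L{τ}` is the source of the twist.
      have hcomm : Ga.scalar F L l ≫ Ga.frob F L =
          Ga.frob F L ≫ Ga.scalar F L (l ^ Fintype.card F) := by
        refine Ga.ext_onSections fun T s => ?_
        change (l • s) ^ Fintype.card F = l ^ Fintype.card F • s ^ Fintype.card F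
        rw [smul_pow]
      change E.frobMotive ((a ⊗ₜ[F] l) • m) = (a ⊗ₜ[F] (l ^ Fintype.card F)) • E.frobMotive m
      rw [tmul_smul_motive, tmul_smul_motive]
      change (E.phi a ≫ (m : E.points ⟶ Ga F L) ≫ Ga.scalar F L l) ≫ Ga.frob F L =
        E.phi a ≫ ((m : E.points ⟶ Ga F L) ≫ Ga.frob F L) ≫ Ga.scalar F L (l ^ Fintype.card F)
      refine (Category.assoc _ _ _).trans (congrArg (E.phi a ≫ ·) ?_)
      exact (Category.assoc _ _ _).trans
        ((congrArg ((m : E.points ⟶ Ga F L) ≫ ·) hcomm).trans (Category.assoc _ _ _).symm)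

theorem frobMotive_iterate (m : E.Motive) (n : ℕ) :
    E.frobMotive^[n] m = (m : E.points ⟶ Ga F L) ≫ Ga.frob F L ^ n := by
  induction n with
  | zero => exact (Category.comp_id _).symm
  | succ n ih =>
    rw [Function.iterate_succ_apply', ih, pow_succ', End.mul_def]
    exact Category.assoc _ _ _

/-- Translates an expansion in `L{τ}` into the `A ⊗ L`-module language; with `m = κ` it expresses
any motive element through the Frobenius iterates of `κ`. -/
theorem comp_sum_scalar_frob (m : E.Motive) (c : ℕ →₀ L) :
    ((m : E.points ⟶ Ga F L) ≫ (c.sum fun n x => Ga.scalar F L x * Ga.frob F L ^ n : End (Ga F L)) :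
      E.Motive) = c.sum fun n x => ((1 : X.A) ⊗ₜ[F] x) • E.frobMotive^[n] m := by
  refine (Preadditive.comp_sum _ _ _).trans (Finset.sum_congr rfl fun n _ => ?_)
  change _ = ((1 : X.A) ⊗ₜ[F] c n) • E.frobMotive^[n] m
  rw [tmul_smul_motive, map_one, frobMotive_iterate]
  exact (Category.assoc _ _ _).symm

end

variable (E : AndersonModule X L 1)

theorem tmul_frobMotive_iterate {κ : E.points ≅ Ga F L} {f : FractionField X L}
    (hf : E.IsShtukaFunction κ f) (n : ℕ) :
    (1 : FractionField X L) ⊗ₜ[X.A ⊗[F] L] E.frobMotive^[n] (E.coord κ) =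
      (∏ i ∈ Finset.range n, (twist X L)^[i] f) •
        ((1 : FractionField X L) ⊗ₜ[X.A ⊗[F] L] E.coord κ) := by
  induction n with
  | zero => simp
  | succ n ih =>
    rw [Function.iterate_succ_apply']
    refine (tmul_eq_smul_of_semilinear (twistTensor_injective X L) (τ := E.frobSemilinear) ih).trans
      ?_
    change twist X L _ • ((1 : FractionField X L) ⊗ₜ[X.A ⊗[F] L] E.frobMotive (E.coord κ)) = _
    -- The twist shifts each factor's index up by one, and the new Frobenius contributes the
    -- untwisted `f` at index `0`.
    rw [hf, smul_smul, map_prod, Finset.prod_range_succ']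
    simp only [Function.iterate_succ_apply', Function.iterate_zero, id]

/-- The Frobenius iterates of `κ` span the motive over `L`. Were `κ` torsion, all of them would be,
and the motive would have rank zero. -/
theorem tmul_coord_ne_zero (hE : E.rank = 1) (κ : E.points ≅ Ga F L) :
    (1 : FractionField X L) ⊗ₜ[X.A ⊗[F] L] E.coord κ ≠ 0 := by
  intro h0
  have hiter : ∀ n, (1 : FractionField X L) ⊗ₜ[X.A ⊗[F] L] E.frobMotive^[n] (E.coord κ) = 0 := by
    have hf : ∀ n : E.Motive, (1 : FractionField X L) ⊗ₜ[X.A ⊗[F] L] n = 0 →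
        (1 : FractionField X L) ⊗ₜ[X.A ⊗[F] L] E.frobMotive n = 0 := fun n hn => by
      -- Coefficient `0` in the semilinear rule says that Frobenius preserves torsion.
      have := tmul_eq_smul_of_semilinear (twistTensor_injective X L) (τ := E.frobSemilinear)
        (K := FractionField X L) (m := n) (n := n) (g := 0) (by rw [hn, zero_smul])
      rwa [map_zero, zero_smul] at this
    intro n
    induction n with
    | zero => exact h0
    | succ n ih => rw [Function.iterate_succ_apply']; exact hf _ ih
  have hall : ∀ m : E.Motive, (1 : FractionField X L) ⊗ₜ[X.A ⊗[F] L] m = 0 := fun m => by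
    obtain ⟨c, hc⟩ := Ga.exists_isTauExpansion (κ.inv ≫ (m : E.points ⟶ Ga F L) : End (Ga F L))
    have hm : m = c.sum fun n x => ((1 : X.A) ⊗ₜ[F] x) • E.frobMotive^[n] (E.coord κ) := by
      rw [← comp_sum_scalar_frob, ← hc]
      exact (Iso.hom_inv_id_assoc κ _).symm
    rw [hm, Finsupp.sum, TensorProduct.tmul_sum]
    exact Finset.sum_eq_zero fun n _ => by rw [TensorProduct.tmul_smul, hiter, smul_zero]
  have hrank : Module.finrank (X.A ⊗[F] L) E.Motive = 0 := by
    rw [Module.finrank, rank_eq_zero_iff.mpr fun m =>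
      (tmul_eq_zero_iff_exists_smul_eq_zero m).mp (hall m), map_zero]
  rw [AndersonModule.rank, hrank] at hE
  exact zero_ne_one hE

theorem finrank_tensor_motive : Module.finrank (FractionField X L)
    (FractionField X L ⊗[X.A ⊗[F] L] E.Motive) = E.rank := by
  rw [IsFractionRing.finrank_right_eq (X.A ⊗[F] L)]
  exact IsLocalizedModule.finrank_eq (nonZeroDivisors (X.A ⊗[F] L))
    (TensorProduct.mk (X.A ⊗[F] L) (FractionField X L) E.Motive 1) le_rfl

/-- A nonzero vector of a one-dimensional space is a basis, and `f` is the coordinate of `Frob_q ∘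
κ` in it. -/
theorem existsUnique_isShtukaFunction (hE : E.rank = 1) (κ : E.points ≅ Ga F L) :
    ∃! f : FractionField X L, E.IsShtukaFunction κ f := by
  have hne := E.tmul_coord_ne_zero hE κ
  obtain ⟨f, hf⟩ := exists_smul_eq_of_finrank_eq_one (E.finrank_tensor_motive.trans hE) hne
    ((1 : FractionField X L) ⊗ₜ[X.A ⊗[F] L] E.frobMotive (E.coord κ))
  refine ⟨f, hf.symm, fun g hg => eq_of_smul_eq_smul_of_ne_zero hne ?_⟩
  exact hg.symm.trans hf.symm

theorem algebraMap_eq_sum_of_isTauExpansion (hE : E.rank = 1) {κ : E.points ≅ Ga F L}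
    {f : FractionField X L} (hf : E.IsShtukaFunction κ f) {a : X.A} {c : ℕ →₀ L}
    (hc : Ga.IsTauExpansion (E.phiCoord κ a) c) :
    algebraMap (X.A ⊗[F] L) (FractionField X L) (a ⊗ₜ[F] (1 : L)) =
      c.sum fun n x => algebraMap (X.A ⊗[F] L) (FractionField X L) ((1 : X.A) ⊗ₜ[F] x) *
        ∏ i ∈ Finset.range n, (twist X L)^[i] f := by
  -- Here `a · κ = κ ∘ φ_a = (κ ∘ φ_a ∘ κ⁻¹) ∘ κ`, and the bracket is expanded in powers of `τ`.
  have ha : (a ⊗ₜ[F] (1 : L)) • E.coord κ =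
      c.sum fun n x => ((1 : X.A) ⊗ₜ[F] x) • E.frobMotive^[n] (E.coord κ) := by
    rw [← comp_sum_scalar_frob, ← hc, tmul_smul_motive, map_one]
    exact (Iso.hom_inv_id_assoc κ _).symm
  refine eq_of_smul_eq_smul_of_ne_zero (E.tmul_coord_ne_zero hE κ) ?_
  rw [algebraMap_smul, ← TensorProduct.tmul_smul, ha, Finsupp.sum, Finsupp.sum,
    TensorProduct.tmul_sum, Finset.sum_smul]
  exact Finset.sum_congr rfl fun n _ => by
    rw [TensorProduct.tmul_smul, E.tmul_frobMotive_iterate hf, mul_smul, algebraMap_smul]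

end AndersonModule
end DrinfeldHayes

end

open DrinfeldHayes
theorem corollary3p18 {F : Type u} [Field F] [Fintype F] (X : PointedCurve F)
    (L : Type u) [Field L] [Algebra F L] [Algebra X.K L] [IsScalarTower F X.K L]
    (E : AndersonModule X L 1) (hE : E.IsDrinfeldHayes) (κ : E.points ≅ Ga F L) :
    (∃! f : FractionField X L, E.IsShtukaFunction κ f) ∧
    (∀ a : X.A, ∃! c : ℕ →₀ L, Ga.IsTauExpansion (E.phiCoord κ a) c) ∧
    ∀ f : FractionField X L, E.IsShtukaFunction κ f →
      ∀ (a : X.A) (c : ℕ →₀ L), Ga.IsTauExpansion (E.phiCoord κ a) c →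
        algebraMap (X.A ⊗[F] L) (FractionField X L) (a ⊗ₜ[F] (1 : L)) =
          c.sum fun n x =>
            algebraMap (X.A ⊗[F] L) (FractionField X L) ((1 : X.A) ⊗ₜ[F] x) *
              ∏ i ∈ Finset.range n, (twist X L)^[i] f := by
  refine ⟨E.existsUnique_isShtukaFunction hE.rank_eq_one κ, fun a => ?_,
    fun f hf a c hc => E.algebraMap_eq_sum_of_isTauExpansion hE.rank_eq_one hf hc⟩
  obtain ⟨c, hc⟩ := Ga.exists_isTauExpansion (E.phiCoord κ a)
  exact ⟨c, hc, fun d hd => hd.unique hc⟩
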